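/- Let $m\ge 1$ and let $(\Omega_n)_{n\in\mathbb N}$ be a sequence of open sets in $\mathbb R^m$ with $0<|\Omega_n|<\infty$ for all $n$, where $|\cdot|$ is Lebesgue measure. For an open set $\Omega\subset\mathbb R^m$ write $d_\Omega(x)=\inf\{|x-y|:y\in\mathbb R^m\setminus\Omega\}$. Suppose that for every $n$ there is a constant $c_{\Omega_n}\in(0,\infty)$ for which the strong Hardy inequality $$\int_{\Omega_n}|\nabla w|^2\ \ge\ \frac1{c_{\Omega_n}}\int_{\Omega_n}\frac{w^2}{d_{\Omega_n}^2}\qquad\text{for all } w\in C_c^\infty(\Omega_n)$$ holds, and that $\sup_n c_{\Omega_n}<\infty$. Suppose also that there are measurable sets $A_n\subset\Omega_n$, $n\in\mathbb N$, with $$\lim_{n\to\infty}\frac{|A_n|}{|\Omega_n|}=1\qquad\text{and}\qquad \lim_{n\to\infty}\frac{\sup_{A_n}d_{\Omega_n}}{\max_{\Omega_n}d_{\Omega_n}}=0 .$$ Let $k\in\{1,2,\dots\}$ and, for each $n$, let $u_{k,\Omega_n}\in H_0^1(\Omega_n)$ be an $L^2$-normalised eigenfunction of the Dirichlet Laplacian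 on $\Omega_n$ for its $k$-th eigenvalue (the eigenvalues being listed in non-decreasing order and repeated according to multiplicity). Then $(u_{k,\Omega_n})_{n}$ localises in $L^2$, that is, $$\sup\Big\{\limsup_{n\to\infty}\frac{\int_{B_n}u_{k,\Omega_n}^2}{\int_{\Omega_n}u_{k,\Omega_n}^2}\ :\ B_n\subset\Omega_n \text{ measurable for all } n,\ \lim_{n\to\infty}\frac{|B_n|}{|\Omega_n|}=0\Big\}=1 .$$ -/

import Mathlib

open MeasureTheory Filter Topology
open scoped ContDiff ENNReal

noncomputable section

namespace DirichletLocalisation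

/-- Euclidean space `ℝ^m`. -/
abbrev Space (m : ℕ) : Type := EuclideanSpace ℝ (Fin m)

/-- `w ∈ C_c^∞(Ω)`, extended by zero to `ℝ^m`. -/
structure IsTestFunction {m : ℕ} (Ω : Set (Space m)) (w : Space m → ℝ) : Prop where
  contDiff : ContDiff ℝ ∞ w
  hasCompactSupport : HasCompactSupport w
  tsupport_subset : tsupport w ⊆ Ω

/-- The distance to the boundary function `d_Ω(x) = inf {|x - y| : y ∈ ℝ^m ∖ Ω}`. -/
def bdryDist {m : ℕ} (Ω : Set (Space m)) (x : Space m) : ℝ :=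
  Metric.infDist x Ωᶜ

/-- The strong Hardy inequality on `Ω` with constant `c ∈ (0,∞)`. -/
def StrongHardy {m : ℕ} (Ω : Set (Space m)) (c : ℝ) : Prop :=
  0 < c ∧ ∀ w : Space m → ℝ, IsTestFunction Ω w →
    (1 / c) * ∫ x in Ω, w x ^ 2 / bdryDist Ω x ^ 2 ≤ ∫ x in Ω, ‖gradient w x‖ ^ 2

/-- Real `L²(Ω)`. -/
abbrev L2 {m : ℕ} (Ω : Set (Space m)) : Type :=
  Lp ℝ 2 (volume.restrict Ω : Measure (Space m))

/-- Square integrable vector fields `L²(Ω; ℝ^m)`. -/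
abbrev L2Vec {m : ℕ} (Ω : Set (Space m)) : Type :=
  Lp (Space m) 2 (volume.restrict Ω : Measure (Space m))

/-- The pairs `(w, ∇w)` with `w ∈ C_c^∞(Ω)`, in the Hilbert space `L²(Ω) × L²(Ω; ℝ^m)`,
whose inner product induces the `H¹` inner product on such pairs. -/
def testGraph {m : ℕ} (Ω : Set (Space m)) : Submodule ℝ (WithLp 2 (L2 Ω × L2Vec Ω)) where
  carrier := {p | ∃ w : Space m → ℝ, IsTestFunction Ω w ∧
    p.fst =ᵐ[volume.restrict Ω] w ∧ p.snd =ᵐ[volume.restrict Ω] gradient w}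
  zero_mem' := by
    refine ⟨0, ⟨contDiff_const, HasCompactSupport.zero, by simp [tsupport]⟩, ?_, ?_⟩
    · exact Lp.coeFn_zero ℝ 2 _
    · have h : gradient (0 : Space m → ℝ) = 0 := by
        ext1 x
        simp [gradient]
      rw [h]
      exact Lp.coeFn_zero (Space m) 2 _
  add_mem' := by
    rintro p q ⟨v, hv, hp1, hp2⟩ ⟨w, hw, hq1, hq2⟩
    refine ⟨v + w, ⟨hv.contDiff.add hw.contDiff, hv.hasCompactSupport.add hw.hasCompactSupport,
      (tsupport_add v w).trans (Set.union_subset hv.tsupport_subset hw.tsupport_subset)⟩, ?_, ?_⟩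
    · exact (Lp.coeFn_add p.fst q.fst).trans (hp1.add hq1)
    · have h : gradient (v + w) = gradient v + gradient w := by
        ext1 x
        have h1 : DifferentiableAt ℝ v x := (hv.contDiff.differentiable (by simp)) x
        have h2 : DifferentiableAt ℝ w x := (hw.contDiff.differentiable (by simp)) x
        simp [gradient, fderiv_add h1 h2]
      rw [h]
      exact (Lp.coeFn_add p.snd q.snd).trans (hp2.add hq2)
  smul_mem' := by
    rintro a p ⟨w, hw, hp1, hp2⟩
    refine ⟨a • w, ⟨contDiff_const.smul hw.contDiff, hw.hasCompactSupport.smul_left,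
      (closure_mono (Function.support_const_smul_subset a w)).trans hw.tsupport_subset⟩, ?_, ?_⟩
    · exact (Lp.coeFn_smul a p.fst).trans (hp1.const_smul a)
    · have h : gradient (a • w) = a • gradient w := by
        ext1 x
        have h1 : DifferentiableAt ℝ w x := (hw.contDiff.differentiable (by simp)) x
        simp [gradient, fderiv_const_smul h1]
      rw [h]
      exact (Lp.coeFn_smul a p.snd).trans (hp2.const_smul a)

/-- The Sobolev space `H_0^1(Ω)`: the closure of `C_c^∞(Ω)` in the `H¹` norm. An element is
recorded as the pair `(u, ∇u)` of the function and its weak gradient. -/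
def H10 {m : ℕ} (Ω : Set (Space m)) : Submodule ℝ (WithLp 2 (L2 Ω × L2Vec Ω)) :=
  (testGraph Ω).topologicalClosure

/-- The eigenspace of the Dirichlet Laplacian on `Ω` for the number `μ`: all `u ∈ H_0^1(Ω)`
with `∫_Ω ∇u · ∇v = μ ∫_Ω u v` for every `v ∈ H_0^1(Ω)` (it is zero when `μ` is not an
eigenvalue). -/
def dirichletEigenspace {m : ℕ} (Ω : Set (Space m)) (μ : ℝ) : Submodule ℝ (L2 Ω) where
  carrier := {u | ∃ g : L2Vec Ω, WithLp.toLp 2 (u, g) ∈ H10 Ω ∧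
    ∀ p ∈ H10 Ω, inner ℝ g p.snd = μ * inner ℝ u p.fst}
  zero_mem' := ⟨0, (H10 Ω).zero_mem, fun p _ => by simp⟩
  add_mem' := by
    rintro u v ⟨g, hg, hu⟩ ⟨h, hh, hv⟩
    refine ⟨g + h, (H10 Ω).add_mem hg hh, fun p hp => ?_⟩
    rw [inner_add_left, inner_add_left, hu p hp, hv p hp, mul_add]
  smul_mem' := by
    rintro a u ⟨g, hg, hu⟩
    refine ⟨a • g, (H10 Ω).smul_mem a hg, fun p hp => ?_⟩
    rw [real_inner_smul_left, real_inner_smul_left, hu p hp]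
    ring

/-- `μ` is the `k`-th Dirichlet eigenvalue of `Ω` (`k = 1, 2, …`), i.e. the `k`-th entry in the
list `λ_1 ≤ λ_2 ≤ …` of all eigenvalues repeated according to multiplicity: fewer than `k`
entries are `< μ`, and at least `k` entries are `≤ μ`. -/
def IsKthDirichletEigenvalue {m : ℕ} (Ω : Set (Space m)) (k : ℕ) (μ : ℝ) : Prop :=
  Module.rank ℝ ↥(⨆ ν ∈ Set.Iio μ, dirichletEigenspace Ω ν) < (k : Cardinal) ∧
    (k : Cardinal) ≤ Module.rank ℝ ↥(⨆ ν ∈ Set.Iic μ, dirichletEigenspace Ω ν)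

/-- `u` is an `L²`-normalised eigenfunction for the `k`-th Dirichlet eigenvalue of `Ω`. -/
def IsKthDirichletEigenfunction {m : ℕ} (Ω : Set (Space m)) (k : ℕ) (u : L2 Ω) : Prop :=
  ∃ μ : ℝ, IsKthDirichletEigenvalue Ω k μ ∧ u ∈ dirichletEigenspace Ω μ ∧ ‖u‖ = 1

/-- The sequences `(A_n)` of Lebesgue measurable sets `A_n ⊆ Ω_n` with `|A_n| / |Ω_n| → 0`. -/
def vanishingSequences {m : ℕ} (Ω : ℕ → Set (Space m)) : Set (ℕ → Set (Space m)) :=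
  {A | (∀ n, A n ⊆ Ω n ∧ NullMeasurableSet (A n) (volume : Measure (Space m))) ∧
    Tendsto (fun n => (volume (A n) : ℝ≥0∞) / volume (Ω n)) atTop (𝓝 0)}

/-- `κ = sup { limsup_n ‖f_n 1_{A_n}‖_p^p / ‖f_n‖_p^p }`, the supremum being over the sequences
`(A_n)` of measurable `A_n ⊆ Ω_n` with `|A_n| / |Ω_n| → 0`. -/
def localisationConstant {m : ℕ} (p : ℝ) (Ω : ℕ → Set (Space m)) (f : ℕ → Space m → ℝ) :
    ℝ≥0∞ :=
  ⨆ A ∈ vanishingSequences Ω,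
    limsup (fun n => (∫⁻ x in A n, ‖f n x‖ₑ ^ p) / ∫⁻ x in Ω n, ‖f n x‖ₑ ^ p) atTop

/-- `(f_n)`, `f_n : Ω_n → ℝ`, localises in `L^p`: `κ = 1`. -/
def LocalisesInLp {m : ℕ} (p : ℝ) (Ω : ℕ → Set (Space m)) (f : ℕ → Space m → ℝ) : Prop :=
  localisationConstant p Ω f = 1

end DirichletLocalisation

end

/-!
The Hardy inequality extends by density to an eigenfunction `u` with `‖u‖ = 1` and eigenvalue `μ`,
for which `∫ |∇u|² = μ`. On a subset `A` of `Ω` the distance to the boundary is at most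
`S = sup_A d_Ω`, so `∫_A u² ≤ S² ∫_Ω u² / d_Ω² ≤ S² c μ`
(`StrongHardy.lintegral_eigenfunction_le`). If `D = sup_Ω d_Ω`, then `Ω` contains a ball of radius
greater than `D / 2`, and hence `μ ≤ K / D²` with `K` depending on `m` and `k` only
(`exists_forall_eigenvalue_le`). Together, `∫_A u² ≤ K c (S / D)²`. When `S / D → 0` with `c`
bounded, the mass of `u` therefore escapes to `Ω \ A`, which has vanishing relative measure when
`|A| / |Ω| → 1` (`localisesInLp_two_of_tendsto`).

The bound on `μ` is the upper half of the min-max principle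
(`IsKthDirichletEigenvalue.le_of_rayleigh_le`), applied to `k` disjoint translates of a scaled bump
function. As eigenvalues are counted through the eigenspaces themselves, it rests on the following
fact (`le_of_rayleigh_le_of_mem_orthogonal`): a function orthogonal to the finitely many
eigenfunctions with eigenvalue `< μ` has Rayleigh quotient at least `μ`. Otherwise a minimiser among
such functions would be another eigenfunction with eigenvalue `< μ`. A minimiser exists because the
embedding of `H_0^1(Ω)` into `L²(Ω)` is compact when `|Ω| < ∞` (`isCompactOperator_embedding`):
averaging at scale `ε` moves `u` by at most `ε ‖∇u‖` in `L²`, and on a set of finite measure it is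
an operator with square integrable kernel, hence compact.
-/

namespace DirichletLocalisation

/-! ### Compact operators on Hilbert spaces -/

/-- An integral operator whose kernel is a square integrable Hilbert-space-valued function is
compact: it is of rank one for an indicator kernel, and depends continuously on the kernel. -/
theorem isCompactOperator_innerKernel {X G : Type*} [MeasurableSpace X] {ν : Measure X}
    [NormedAddCommGroup G] [InnerProductSpace ℝ G] (K : Lp G 2 ν) :
    IsCompactOperator (((innerSL ℝ : G →L[ℝ] G →L[ℝ] ℝ).compLpL₂ 2 ν).flip K) := by
  induction K using Lp.induction (p := 2) ENNReal.ofNat_ne_top with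
  | @indicatorConst c s hs hμs =>
    set e : Lp ℝ 2 ν := indicatorConstLp 2 hs hμs.ne (1 : ℝ)
    have h : ((innerSL ℝ : G →L[ℝ] G →L[ℝ] ℝ).compLpL₂ 2 ν).flip
        (Lp.simpleFunc.indicatorConst 2 hs hμs.ne c : Lp G 2 ν) =
        (ContinuousLinearMap.toSpanSingleton ℝ e).comp (innerSL ℝ c) := by
      ext1 g
      apply Lp.ext
      rw [Lp.simpleFunc.coe_indicatorConst]
      refine ((innerSL ℝ g).coeFn_compLp' (indicatorConstLp 2 hs hμs.ne c)).trans ?_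
      have h1 := indicatorConstLp_coeFn (p := 2) (hs := hs) (hμs := hμs.ne) (c := c)
      have h2 := indicatorConstLp_coeFn (p := 2) (hs := hs) (hμs := hμs.ne) (c := (1 : ℝ))
      have h3 := Lp.coeFn_smul (inner ℝ c g) e
      filter_upwards [h1, h2, h3] with x h1 h2 h3
      simp only [ContinuousLinearMap.comp_apply, ContinuousLinearMap.toSpanSingleton_apply,
        innerSL_apply_apply]
      rw [h3, h1, Pi.smul_apply, h2]
      by_cases hx : x ∈ s <;> simp [hx, real_inner_comm]
    rw [h]
    exact (isCompactOperator_of_locallyCompactSpace_rng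
      (ContinuousLinearMap.toSpanSingleton ℝ e)).comp_clm (innerSL ℝ c)
  | add hf hg _ h1 h2 =>
    rw [map_add]
    exact h1.add h2
  | isClosed =>
    exact isClosed_setOfPred_isCompactOperator.preimage
      ((innerSL ℝ : G →L[ℝ] G →L[ℝ] ℝ).compLpL₂ 2 ν).flip.continuous

theorem isCompactOperator_of_forall_approx {M F : Type*} [NormedAddCommGroup M]
    [NormedSpace ℝ M] [NormedAddCommGroup F] [NormedSpace ℝ F] [CompleteSpace F] (J : M →L[ℝ] F)
    (h : ∀ ε > 0, ∃ T : M →L[ℝ] F, IsCompactOperator T ∧ ∀ x, ‖J x - T x‖ ≤ ε * ‖x‖) :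
    IsCompactOperator J := by
  refine isClosed_setOfPred_isCompactOperator.closure_subset (Metric.mem_closure_iff.mpr ?_)
  intro ε hε
  obtain ⟨T, hTc, hT⟩ := h (ε / 2) (by positivity)
  refine ⟨T, hTc, ?_⟩
  rw [dist_eq_norm]
  have : ‖J - T‖ ≤ ε / 2 := ContinuousLinearMap.opNorm_le_bound _ (by positivity) hT
  linarith

/-- The quotient `‖J x‖² / ‖x‖²` of a compact operator attains its supremum `τ`, at a solution `g`
of the corresponding Euler–Lagrange equation. -/
theorem exists_maximiser_of_isCompactOperator {M F : Type*} [NormedAddCommGroup M]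
    [InnerProductSpace ℝ M] [CompleteSpace M] [NormedAddCommGroup F] [InnerProductSpace ℝ F]
    [CompleteSpace F] (J : M →L[ℝ] F) (hJ : IsCompactOperator J) {w : M} (hw : J w ≠ 0) :
    ∃ (g : M) (τ : ℝ), g ≠ 0 ∧ (∀ x, inner ℝ (J g) (J x) = τ * inner ℝ g x) ∧
      ∀ x, ‖J x‖ ^ 2 ≤ τ * ‖x‖ ^ 2 := by
  set T : M →L[ℝ] M := J.adjoint.comp J with hT
  have hTin : ∀ x y, inner ℝ (T x) y = inner ℝ (J x) (J y) := fun x y => by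
    simp [hT, ContinuousLinearMap.adjoint_inner_left]
  have hTc : IsCompactOperator T := hJ.clm_comp J.adjoint
  have hsymm : T.IsSymmetric := fun x y => by
    change inner ℝ (T x) y = inner ℝ x (T y)
    rw [hTin, real_inner_comm (T y) x, hTin, real_inner_comm]
  have hR : ∀ x, T.rayleighQuotient x = ‖J x‖ ^ 2 / ‖x‖ ^ 2 := fun x => by
    simp [ContinuousLinearMap.rayleighQuotient, ContinuousLinearMap.reApplyInnerSelf_apply, hTin]
  have hw0 : w ≠ 0 := by rintro rfl; simp at hw
  have : Nontrivial M := ⟨w, 0, hw0⟩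
  have hTne : ‖T‖ ≠ 0 := by
    intro h
    have h0 : T = 0 := norm_eq_zero.mp h
    have := hTin w w
    rw [h0] at this
    simp at this
    exact hw (by simpa using this.symm)
  -- `T = J†J` is positive, so `‖T‖` is the supremum of its Rayleigh quotient and lies in the
  -- spectrum; by compactness it is then an eigenvalue.
  have hspec : ‖T‖ ∉ resolventSet ℝ T := by
    intro h
    obtain ⟨ε, hε, hle⟩ := T.rayleighQuotient_le_of_norm_mem_resolventSet (𝕜 := ℝ)
      (by simpa using h)
    have h1 := T.norm_eq_iSup_rayleighQuotient hsymm
    have h2 : (⨆ x, |T.rayleighQuotient x|) ≤ ‖T‖ - ε := ciSup_le fun x => by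
      rw [abs_of_nonneg (by rw [hR]; positivity)]
      exact hle x
    linarith
  have hev := (hTc.hasEigenvalue_or_mem_resolventSet hTne).resolve_right hspec
  obtain ⟨g, hg⟩ := hev.exists_hasEigenvector
  refine ⟨g, ‖T‖, hg.2, fun x => ?_, fun x => ?_⟩
  · rw [← hTin]
    have : T g = ‖T‖ • g := hg.apply_eq_smul
    rw [this, real_inner_smul_left]
  · rw [← real_inner_self_eq_norm_sq, ← hTin]
    calc inner ℝ (T x) x ≤ ‖T x‖ * ‖x‖ := real_inner_le_norm _ _
      _ ≤ (‖T‖ * ‖x‖) * ‖x‖ := by gcongr; exact T.le_opNorm x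
      _ = _ := by ring

/-- The maximisation of `‖J x‖² / ‖x‖²` over a closed subspace. -/
theorem exists_maximiser_mem_of_isCompactOperator {H F : Type*} [NormedAddCommGroup H]
    [InnerProductSpace ℝ H] [CompleteSpace H] [NormedAddCommGroup F] [InnerProductSpace ℝ F]
    [CompleteSpace F] (J : H →L[ℝ] F) (hJ : IsCompactOperator J) (M : Submodule ℝ H)
    (hM : IsClosed (M : Set H)) {w : H} (hwM : w ∈ M) (hw : J w ≠ 0) :
    ∃ g ∈ M, ∃ τ : ℝ, g ≠ 0 ∧ (∀ x ∈ M, inner ℝ (J g) (J x) = τ * inner ℝ g x) ∧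
      ∀ x ∈ M, ‖J x‖ ^ 2 ≤ τ * ‖x‖ ^ 2 := by
  have : CompleteSpace M := hM.completeSpace_coe
  obtain ⟨⟨g, hgM⟩, τ, hg0, hg, hτ⟩ := exists_maximiser_of_isCompactOperator
    (J.comp M.subtypeL) (hJ.comp_clm M.subtypeL) (w := ⟨w, hwM⟩) hw
  exact ⟨g, hgM, τ, fun h => hg0 (Subtype.ext h), fun x hx => hg ⟨x, hx⟩, fun x hx => hτ ⟨x, hx⟩⟩

/-! ### Mollification in `L²` -/

/-- Jensen's inequality for the square. -/
theorem sq_lintegral_le_lintegral_sq {X : Type*} [MeasurableSpace X] (P : Measure X)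
    [IsProbabilityMeasure P] {f : X → ℝ≥0∞} (hf : AEMeasurable f P) :
    (∫⁻ x, f x ∂P) ^ 2 ≤ ∫⁻ x, f x ^ 2 ∂P := by
  have h := ENNReal.lintegral_mul_le_Lp_mul_Lq P Real.HolderConjugate.two_two hf
    (aemeasurable_const (b := (1 : ℝ≥0∞)))
  simp only [Pi.mul_apply, mul_one, ENNReal.one_rpow, lintegral_const, measure_univ] at h
  calc (∫⁻ x, f x ∂P) ^ 2 ≤ ((∫⁻ x, f x ^ (2 : ℝ) ∂P) ^ (1 / (2 : ℝ))) ^ 2 := by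
        gcongr
    _ = ∫⁻ x, f x ^ 2 ∂P := by
        rw [← ENNReal.rpow_natCast, ← ENNReal.rpow_mul]
        simp

section

variable {m : ℕ} {w : Space m → ℝ}

theorem norm_gradient_eq (w : Space m → ℝ) (x : Space m) : ‖gradient w x‖ = ‖fderiv ℝ w x‖ := by
  simp [gradient]

theorem continuous_gradient (hw : ContDiff ℝ ∞ w) : Continuous (gradient w) :=
  (InnerProductSpace.toDual ℝ (Space m)).symm.continuous.comp (hw.continuous_fderiv (by simp))

theorem hasCompactSupport_gradient (hw : HasCompactSupport w) :
    HasCompactSupport (gradient w) :=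
  (hw.fderiv ℝ).comp_left (g := (InnerProductSpace.toDual ℝ (Space m)).symm) (map_zero _)

/-- The increment of a smooth function is the integral of its derivative along the segment. -/
theorem enorm_sub_translate_le (hw : ContDiff ℝ ∞ w) (x h : Space m) :
    ‖w x - w (x - h)‖ₑ ≤
      ∫⁻ t in Set.Icc (0 : ℝ) 1, ‖h‖ₑ * ‖gradient w (x - t • h)‖ₑ := by
  have hd : ∀ t : ℝ, HasDerivAt (fun t : ℝ => w (x - t • h))
      (fderiv ℝ w (x - t • h) (-h)) t := fun t => by
    have h1 : HasDerivAt (fun t : ℝ => x - t • h) (-h) t := by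
      simpa using ((hasDerivAt_id t).smul_const h).const_sub x
    exact ((hw.differentiable (by simp)) _).hasFDerivAt.comp_hasDerivAt t h1
  have hc : Continuous fun t : ℝ => fderiv ℝ w (x - t • h) (-h) :=
    ((hw.continuous_fderiv (by simp)).comp (by fun_prop)).clm_apply continuous_const
  have hI := intervalIntegral.integral_eq_sub_of_hasDerivAt (a := 0) (b := 1)
    (fun t _ => hd t) (hc.intervalIntegrable _ _)
  simp only [one_smul, zero_smul, sub_zero] at hI
  rw [← enorm_neg, neg_sub, ← hI, intervalIntegral.integral_of_le zero_le_one,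
    ← integral_Icc_eq_integral_Ioc]
  refine (enorm_integral_le_lintegral_enorm _).trans (lintegral_mono fun t => ?_)
  rw [← enorm_neg h, mul_comm]
  refine (ContinuousLinearMap.le_opENorm _ _).trans ?_
  gcongr
  rw [← ofReal_norm, ← ofReal_norm, norm_gradient_eq]

/-- Translation by `h` moves `w` by at most `|h| ‖∇w‖` in `L²`. -/
theorem lintegral_sub_translate_sq_le (hw : ContDiff ℝ ∞ w) (h : Space m) :
    ∫⁻ x, ‖w x - w (x - h)‖ₑ ^ 2 ≤ ‖h‖ₑ ^ 2 * ∫⁻ x, ‖gradient w x‖ₑ ^ 2 := by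
  have hg := continuous_gradient hw
  have hP : IsProbabilityMeasure ((volume : Measure ℝ).restrict (Set.Icc 0 1)) :=
    ⟨by simp⟩
  calc ∫⁻ x, ‖w x - w (x - h)‖ₑ ^ 2
      ≤ ∫⁻ x, ∫⁻ t in Set.Icc (0 : ℝ) 1, (‖h‖ₑ * ‖gradient w (x - t • h)‖ₑ) ^ 2 := by
        refine lintegral_mono fun x => ?_
        refine (pow_le_pow_left₀ zero_le (enorm_sub_translate_le hw x h) 2).trans ?_
        refine sq_lintegral_le_lintegral_sq _ ?_
        have : Continuous fun t : ℝ => gradient w (x - t • h) := hg.comp (by fun_prop)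
        exact (this.measurable.enorm.const_mul _).aemeasurable
    _ = ∫⁻ t in Set.Icc (0 : ℝ) 1, ∫⁻ x, (‖h‖ₑ * ‖gradient w (x - t • h)‖ₑ) ^ 2 := by
        refine lintegral_lintegral_swap ?_
        have : Continuous fun p : Space m × ℝ => gradient w (p.1 - p.2 • h) :=
          hg.comp (by fun_prop)
        exact ((this.measurable.enorm.const_mul _).pow_const 2).aemeasurable
    _ = ∫⁻ t in Set.Icc (0 : ℝ) 1, ‖h‖ₑ ^ 2 * ∫⁻ x, ‖gradient w x‖ₑ ^ 2 := by
        refine lintegral_congr fun t => ?_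
        simp_rw [mul_pow]
        rw [lintegral_const_mul _ (by
          have : Continuous fun x : Space m => gradient w (x - t • h) := hg.comp (by fun_prop)
          exact this.measurable.enorm.pow_const 2)]
        congr 1
        exact lintegral_sub_right_eq_self (fun x => ‖gradient w x‖ₑ ^ 2) (t • h)
    _ = ‖h‖ₑ ^ 2 * ∫⁻ x, ‖gradient w x‖ₑ ^ 2 := by simp

/-- Averaging `w` against a bump function supported in the ball of radius `φ.rOut` moves it by at
most `φ.rOut ‖∇w‖` in `L²`. -/
theorem lintegral_sub_average_sq_le (hw : ContDiff ℝ ∞ w)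
    (φ : ContDiffBump (0 : Space m)) :
    ∫⁻ x, ‖w x - ∫ y, φ.normed volume (x - y) * w y‖ₑ ^ 2 ≤
      ENNReal.ofReal φ.rOut ^ 2 * ∫⁻ x, ‖gradient w x‖ₑ ^ 2 := by
  set ρ : Space m → ℝ := φ.normed volume with hρ
  have hρc : Continuous ρ := φ.contDiff_normed (n := 0) |>.continuous
  have hρ1 : ∫ z, ρ z = 1 := φ.integral_normed
  have hρi : Integrable ρ := φ.integrable_normed
  have hρ0 : ∀ z, 0 ≤ ρ z := φ.nonneg_normed
  have hρm : Measurable fun z => ENNReal.ofReal (ρ z) := hρc.measurable.ennreal_ofReal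
  -- Averaging against `ρ` is integration against the probability measure `P`, which allows the use
  -- of Jensen's inequality.
  set P : Measure (Space m) := volume.withDensity fun z => ENNReal.ofReal (ρ z) with hPdef
  have hP : IsProbabilityMeasure P := ⟨by
    rw [hPdef, withDensity_apply _ MeasurableSet.univ, Measure.restrict_univ,
      ← ofReal_integral_eq_lintegral_ofReal hρi (Eventually.of_forall hρ0), hρ1,
      ENNReal.ofReal_one]⟩
  have hwc := hw.continuous
  have hm1 : ∀ x, Measurable fun z => ‖w x - w (x - z)‖ₑ := fun x => by
    have : Continuous fun z => w x - w (x - z) := by fun_prop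
    exact this.measurable.enorm
  have hpt : ∀ x, ‖w x - ∫ y, ρ (x - y) * w y‖ₑ ≤ ∫⁻ z, ‖w x - w (x - z)‖ₑ ∂P := fun x => by
    have h1 : ∫ y, ρ (x - y) * w y = ∫ z, ρ z * w (x - z) := by
      rw [← integral_sub_left_eq_self (fun z => ρ z * w (x - z)) volume x]
      simp
    have h2 : w x = ∫ z, ρ z * w x := by rw [integral_mul_const, hρ1, one_mul]
    have hi : Integrable fun z => ρ z * w (x - z) := by
      refine Continuous.integrable_of_hasCompactSupport (by fun_prop) ?_
      exact (φ.hasCompactSupport_normed (μ := volume)).mul_right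
    have h3 : w x - ∫ y, ρ (x - y) * w y = ∫ z, ρ z * (w x - w (x - z)) := by
      rw [h1]
      nth_rewrite 1 [h2]
      rw [← integral_sub (hρi.mul_const _) hi]
      simp_rw [mul_sub]
    rw [h3, lintegral_withDensity_eq_lintegral_mul _ hρm (hm1 x)]
    refine (enorm_integral_le_lintegral_enorm _).trans (lintegral_mono fun z => ?_)
    rw [enorm_mul, Real.enorm_of_nonneg (hρ0 z)]
    rfl
  have hball : ∀ᵐ z ∂P, z ∈ Metric.ball (0 : Space m) φ.rOut := by
    rw [hPdef, ae_withDensity_iff hρm]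
    refine Eventually.of_forall fun z hz => ?_
    rw [← φ.support_normed_eq (μ := volume)]
    intro h0
    exact hz (by rw [hρ, h0, ENNReal.ofReal_zero])
  set G := ENNReal.ofReal φ.rOut ^ 2 * ∫⁻ x, ‖gradient w x‖ₑ ^ 2 with hG
  have hm2 : Measurable fun p : Space m × Space m => ‖w p.1 - w (p.1 - p.2)‖ₑ ^ 2 := by
    have : Continuous fun p : Space m × Space m => w p.1 - w (p.1 - p.2) := by fun_prop
    exact this.measurable.enorm.pow_const 2
  calc ∫⁻ x, ‖w x - ∫ y, ρ (x - y) * w y‖ₑ ^ 2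
      ≤ ∫⁻ x, ∫⁻ z, ‖w x - w (x - z)‖ₑ ^ 2 ∂P := lintegral_mono fun x =>
        (pow_le_pow_left₀ zero_le (hpt x) 2).trans
          (sq_lintegral_le_lintegral_sq P (hm1 x).aemeasurable)
    _ = ∫⁻ z, (∫⁻ x, ‖w x - w (x - z)‖ₑ ^ 2) ∂P := lintegral_lintegral_swap hm2.aemeasurable
    _ ≤ ∫⁻ _, G ∂P := by
        refine lintegral_mono_ae (hball.mono fun z hz => ?_)
        refine (lintegral_sub_translate_sq_le hw z).trans ?_
        rw [hG]
        gcongr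
        rw [← ofReal_norm]
        exact ENNReal.ofReal_le_ofReal (by simpa using (Metric.mem_ball.mp hz).le)
    _ = G := by simp

end

/-! ### Test functions as elements of `H_0^1(Ω)` -/

theorem enorm_sq_eq_lintegral {X E : Type*} [MeasurableSpace X] {ν : Measure X}
    [NormedAddCommGroup E] (f : Lp E 2 ν) : ‖f‖ₑ ^ 2 = ∫⁻ x, ‖f x‖ₑ ^ 2 ∂ν := by
  rw [Lp.enorm_def, eLpNorm_eq_lintegral_rpow_enorm_toReal (by simp) (by simp),
    ← ENNReal.rpow_natCast, ← ENNReal.rpow_mul]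
  simp

section

variable {m : ℕ} {Ω : Set (Space m)} {w : Space m → ℝ}

theorem IsTestFunction.eq_zero_of_notMem (hw : IsTestFunction Ω w) {x : Space m} (hx : x ∉ Ω) :
    w x = 0 :=
  image_eq_zero_of_notMem_tsupport fun h => hx (hw.tsupport_subset h)

theorem IsTestFunction.gradient_eq_zero_of_notMem (hw : IsTestFunction Ω w) {x : Space m}
    (hx : x ∉ Ω) : gradient w x = 0 := by
  have : fderiv ℝ w x = 0 := by
    by_contra h
    exact hx (hw.tsupport_subset (support_fderiv_subset ℝ h))
  simp [gradient, this]

theorem IsTestFunction.memLp (hw : IsTestFunction Ω w) (ν : Measure (Space m))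
    [IsFiniteMeasureOnCompacts ν] : MemLp w 2 ν :=
  hw.contDiff.continuous.memLp_of_hasCompactSupport hw.hasCompactSupport

theorem IsTestFunction.memLp_gradient (hw : IsTestFunction Ω w) (ν : Measure (Space m))
    [IsFiniteMeasureOnCompacts ν] : MemLp (gradient w) 2 ν :=
  (continuous_gradient hw.contDiff).memLp_of_hasCompactSupport
    (hasCompactSupport_gradient hw.hasCompactSupport)

/-- The element `(w, ∇w)` of `H_0^1(Ω)` given by a test function `w`. -/
noncomputable def IsTestFunction.toH10 (hw : IsTestFunction Ω w) :
    WithLp 2 (L2 Ω × L2Vec Ω) :=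
  WithLp.toLp 2 ((hw.memLp _).toLp w, (hw.memLp_gradient _).toLp (gradient w))

theorem IsTestFunction.toH10_mem (hw : IsTestFunction Ω w) : hw.toH10 ∈ H10 Ω :=
  (testGraph Ω).le_topologicalClosure
    ⟨w, hw, (hw.memLp _).coeFn_toLp, (hw.memLp_gradient _).coeFn_toLp⟩

theorem IsTestFunction.toH10_fst (hw : IsTestFunction Ω w) :
    hw.toH10.fst =ᵐ[volume.restrict Ω] w := (hw.memLp _).coeFn_toLp

theorem IsTestFunction.toH10_snd (hw : IsTestFunction Ω w) :
    hw.toH10.snd =ᵐ[volume.restrict Ω] gradient w := (hw.memLp_gradient _).coeFn_toLp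

/-- A closed relation between `u` and `∇u` holds on `H_0^1(Ω)` as soon as it holds for test
functions. -/
theorem H10_induction {S : Set (WithLp 2 (L2 Ω × L2Vec Ω))} (hS : IsClosed S)
    (h : ∀ w (hw : IsTestFunction Ω w), hw.toH10 ∈ S) {p : WithLp 2 (L2 Ω × L2Vec Ω)}
    (hp : p ∈ H10 Ω) : p ∈ S := by
  refine closure_minimal ?_ hS hp
  rintro p ⟨w, hw, h1, h2⟩
  have : p = hw.toH10 := by
    have e1 : p.fst = (hw.memLp _).toLp w := Lp.ext (h1.trans (MemLp.coeFn_toLp _).symm)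
    have e2 : p.snd = (hw.memLp_gradient _).toLp (gradient w) :=
      Lp.ext (h2.trans (MemLp.coeFn_toLp _).symm)
    rw [IsTestFunction.toH10, ← e1, ← e2]
    rfl
  rw [this]
  exact h w hw

end

/-! ### Compactness of the embedding of `H_0^1(Ω)` into `L²(Ω)` -/

section

variable {m : ℕ}

/-- The embedding `(u, ∇u) ↦ u` of `H_0^1(Ω)` into `L²(Ω)`. -/
noncomputable def embedding (Ω : Set (Space m)) : H10 Ω →L[ℝ] L2 Ω :=
  (WithLp.fstL 2 ℝ (L2 Ω) (L2Vec Ω)).comp (H10 Ω).subtypeL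

variable {Ω : Set (Space m)}

/-- On a set of finite measure, averaging against a bump function is an operator with square
integrable kernel `x ↦ φ(x - ·)`. -/
theorem exists_compact_average (hfin : volume Ω < ⊤) (φ : ContDiffBump (0 : Space m)) :
    ∃ S : L2 Ω →L[ℝ] L2 Ω, IsCompactOperator S ∧ ∀ u : L2 Ω, ∀ᵐ x ∂(volume.restrict Ω),
      S u x = ∫ y in Ω, φ.normed volume (x - y) * u y := by
  have : IsFiniteMeasure ((volume : Measure (Space m)).restrict Ω) :=
    ⟨by rwa [Measure.restrict_apply_univ]⟩
  set ρ : Space m → ℝ := φ.normed volume with hρ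
  have hρs : ContDiff ℝ 1 ρ := φ.contDiff_normed
  have hρc : HasCompactSupport ρ := φ.hasCompactSupport_normed
  have hcont := hρs.continuous
  obtain ⟨L, hL⟩ := hρs.lipschitzWith_of_hasCompactSupport hρc one_ne_zero
  obtain ⟨B, hB⟩ := hρc.exists_bound_of_continuous hcont
  have hmem : ∀ x, MemLp (fun y => ρ (x - y)) 2 ((volume : Measure (Space m)).restrict Ω) :=
    fun x => MemLp.of_bound (by fun_prop) B (Eventually.of_forall fun y => hB _)
  set κ : Space m → L2 Ω := fun x => (hmem x).toLp _ with hκ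
  set V : ℝ := measureUnivNNReal ((volume : Measure (Space m)).restrict Ω) ^
    (2 : ℝ≥0∞).toReal⁻¹ with hV
  have hV0 : 0 ≤ V := by positivity
  have hB0 : 0 ≤ B := (norm_nonneg _).trans (hB 0)
  have hκb : ∀ x, ‖κ x‖ ≤ V * B := fun x => Lp.norm_le_of_ae_bound hB0 (by
    filter_upwards [(hmem x).coeFn_toLp] with y hy
    rw [hκ]
    simp only
    rw [hy]
    exact hB _)
  -- Continuity of `κ` is needed only for its measurability as an `L²(Ω)`-valued map.
  have hκL : LipschitzWith (V.toNNReal * L) κ := by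
    refine LipschitzWith.of_dist_le_mul fun x x' => ?_
    rw [dist_eq_norm, NNReal.coe_mul, Real.coe_toNNReal _ hV0, mul_assoc]
    refine Lp.norm_le_of_ae_bound (by positivity) ?_
    filter_upwards [(hmem x).coeFn_toLp, (hmem x').coeFn_toLp, Lp.coeFn_sub (κ x) (κ x')]
      with y h1 h2 h3
    rw [h3, Pi.sub_apply]
    simp only [hκ]
    rw [h1, h2, ← dist_eq_norm]
    refine (hL.dist_le_mul _ _).trans ?_
    rw [dist_sub_right]
  have hκm : MemLp κ 2 ((volume : Measure (Space m)).restrict Ω) :=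
    MemLp.of_bound hκL.continuous.aestronglyMeasurable (V * B) (Eventually.of_forall hκb)
  refine ⟨_, isCompactOperator_innerKernel (hκm.toLp κ), fun u => ?_⟩
  filter_upwards [(innerSL ℝ u).coeFn_compLp' (hκm.toLp κ), hκm.coeFn_toLp] with x h1 h2
  refine h1.trans ?_
  rw [h2, innerSL_apply_apply, L2.inner_def]
  refine integral_congr_ae ?_
  filter_upwards [(hmem x).coeFn_toLp] with y hy
  simp only [hκ]
  rw [hy]
  simp

/-- Averaging at scale `ε` is a compact operator within `ε` of the embedding in operator norm, by
density of the test functions. No boundedness of `Ω` is needed. -/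
theorem isCompactOperator_embedding (hfin : volume Ω < ⊤) :
    IsCompactOperator (embedding Ω) := by
  refine isCompactOperator_of_forall_approx _ fun ε hε => ?_
  let φ : ContDiffBump (0 : Space m) := ⟨ε / 2, ε, by positivity, by linarith⟩
  obtain ⟨S, hSc, hS⟩ := exists_compact_average hfin φ
  refine ⟨S.comp (embedding Ω), hSc.comp_clm _, fun p => ?_⟩
  have hclosed : IsClosed {p : WithLp 2 (L2 Ω × L2Vec Ω) | ‖p.fst - S p.fst‖ ≤ ε * ‖p.snd‖} := by
    have h1 : Continuous fun p : WithLp 2 (L2 Ω × L2Vec Ω) => p.fst :=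
      (WithLp.fstL 2 ℝ (L2 Ω) (L2Vec Ω)).continuous
    have h2 : Continuous fun p : WithLp 2 (L2 Ω × L2Vec Ω) => p.snd :=
      (WithLp.sndL 2 ℝ (L2 Ω) (L2Vec Ω)).continuous
    exact isClosed_le (h1.sub (S.continuous.comp h1)).norm (continuous_const.mul h2.norm)
  have hmain : ‖(p : WithLp 2 (L2 Ω × L2Vec Ω)).fst - S (p : WithLp 2 (L2 Ω × L2Vec Ω)).fst‖
      ≤ ε * ‖(p : WithLp 2 (L2 Ω × L2Vec Ω)).snd‖ := by
    refine H10_induction hclosed (fun w hw => ?_) p.2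
    set f : L2 Ω := hw.toH10.fst with hf
    set g : L2Vec Ω := hw.toH10.snd with hg
    have hfw : f =ᵐ[volume.restrict Ω] w := hw.toH10_fst
    have hgw : g =ᵐ[volume.restrict Ω] gradient w := hw.toH10_snd
    have hle : ‖f - S f‖ₑ ^ 2 ≤ (ENNReal.ofReal ε * ‖g‖ₑ) ^ 2 := by
      rw [mul_pow, enorm_sq_eq_lintegral, enorm_sq_eq_lintegral]
      calc ∫⁻ x in Ω, ‖(f - S f) x‖ₑ ^ 2
          = ∫⁻ x in Ω, ‖w x - ∫ y, φ.normed volume (x - y) * w y‖ₑ ^ 2 := by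
            refine lintegral_congr_ae ?_
            filter_upwards [Lp.coeFn_sub f (S f), hS f, hfw] with x h1 h2 h3
            rw [h1, Pi.sub_apply, h2, h3]
            congr 3
            rw [← setIntegral_eq_integral_of_forall_compl_eq_zero (s := Ω) 
              (f := fun y => φ.normed volume (x - y) * w y)
              fun y hy => by rw [hw.eq_zero_of_notMem hy, mul_zero]]
            refine integral_congr_ae ?_
            filter_upwards [hfw] with y hy
            rw [hy]
        _ ≤ ∫⁻ x, ‖w x - ∫ y, φ.normed volume (x - y) * w y‖ₑ ^ 2 := setLIntegral_le_lintegral _ _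
        _ ≤ ENNReal.ofReal ε ^ 2 * ∫⁻ x, ‖gradient w x‖ₑ ^ 2 :=
            lintegral_sub_average_sq_le hw.contDiff φ
        _ = ENNReal.ofReal ε ^ 2 * ∫⁻ x in Ω, ‖g x‖ₑ ^ 2 := by
            congr 1
            rw [← setLIntegral_eq_of_support_subset (s := Ω)]
            · refine lintegral_congr_ae ?_
              filter_upwards [hgw] with x hx
              rw [hx]
            · intro x hx
              by_contra h
              exact hx (by simp [hw.gradient_eq_zero_of_notMem h])
    have h2 := (ENNReal.pow_le_pow_left_iff two_ne_zero).mp hle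
    rw [← ofReal_norm, ← ofReal_norm, ← ENNReal.ofReal_mul hε.le,
      ENNReal.ofReal_le_ofReal_iff (by positivity)] at h2
    exact h2
  refine hmain.trans ?_
  gcongr
  exact WithLp.norm_snd_le _ _

end

/-! ### The variational upper bound for eigenvalues -/

section

variable {m : ℕ} {Ω : Set (Space m)}

theorem inner_eq_fst_add_snd (p q : WithLp 2 (L2 Ω × L2Vec Ω)) :
    inner ℝ p q = inner ℝ p.fst q.fst + inner ℝ p.snd q.snd := rfl

theorem norm_sq_eq_fst_add_snd (p : WithLp 2 (L2 Ω × L2Vec Ω)) :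
    ‖p‖ ^ 2 = ‖p.fst‖ ^ 2 + ‖p.snd‖ ^ 2 := by
  simp only [← real_inner_self_eq_norm_sq]
  rfl

theorem completeSpace_H10 (Ω : Set (Space m)) : CompleteSpace (H10 Ω) :=
  (Submodule.isClosed_topologicalClosure _).completeSpace_coe

/-- If a function in `H_0^1(Ω)`, orthogonal in `L²` to all eigenfunctions with eigenvalue `< μ`, has
Rayleigh quotient at most `C`, then `μ ≤ C`. Otherwise, minimising the Rayleigh quotient among such
functions, which is possible by compactness, would produce a further eigenfunction with eigenvalue
at most `C < μ`. -/
theorem le_of_rayleigh_le_of_mem_orthogonal (hfin : volume Ω < ⊤) {μ C : ℝ}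
    {V : Submodule ℝ (L2 Ω)} [FiniteDimensional ℝ V]
    (hV : V = ⨆ ν ∈ Set.Iio μ, dirichletEigenspace Ω ν)
    {w : WithLp 2 (L2 Ω × L2Vec Ω)} (hw : w ∈ H10 Ω) (hw0 : w.fst ≠ 0) (hwV : w.fst ∈ Vᗮ)
    (hwC : ‖w.snd‖ ^ 2 ≤ C * ‖w.fst‖ ^ 2) : μ ≤ C := by
  by_contra! hlt
  have hpos : 0 < ‖w.fst‖ ^ 2 := by positivity
  have := completeSpace_H10 Ω
  obtain ⟨⟨g, hgH⟩, hgV, τ, hg0, hg, hτ⟩ := exists_maximiser_mem_of_isCompactOperator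
    (embedding Ω) (isCompactOperator_embedding hfin) (Vᗮ.comap (embedding Ω).toLinearMap)
    ((Submodule.isClosed_orthogonal V).preimage (embedding Ω).continuous)
    (w := ⟨w, hw⟩) hwV hw0
  replace hgV : g.fst ∈ Vᗮ := hgV
  have hg' : ∀ p ∈ H10 Ω, p.fst ∈ Vᗮ → inner ℝ g.fst p.fst = τ * inner ℝ g p :=
    fun p hp hpV => hg ⟨p, hp⟩ hpV
  have hτw : ‖w.fst‖ ^ 2 ≤ τ * ‖w‖ ^ 2 := hτ ⟨w, hw⟩ hwV
  have hτ0 : 0 < τ := by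
    by_contra! h
    nlinarith [sq_nonneg ‖w‖]
  -- The maximum `τ` of `‖u‖² / ‖u‖²_{H¹}` corresponds to the eigenvalue `1 / τ - 1 ≤ C`.
  have hτC : 1 ≤ τ * (1 + C) := by
    rw [norm_sq_eq_fst_add_snd] at hτw
    have : ‖w.fst‖ ^ 2 * 1 ≤ ‖w.fst‖ ^ 2 * (τ * (1 + C)) := by nlinarith
    exact le_of_mul_le_mul_left this hpos
  -- Every element of `V` lifts to an element of `H_0^1(Ω)` that is orthogonal to `g`.
  have hVlift : V ≤ (H10 Ω ⊓ (ℝ ∙ g)ᗮ).map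
      (WithLp.fstL 2 ℝ (L2 Ω) (L2Vec Ω)).toLinearMap := by
    conv_lhs => rw [hV]
    refine iSup₂_le fun ν hν => ?_
    rintro u ⟨h, hmem, hu⟩
    refine ⟨WithLp.toLp 2 (u, h), ⟨hmem, ?_⟩, rfl⟩
    have huV : u ∈ V := by
      rw [hV]
      exact (le_iSup₂ (f := fun ν (_ : ν ∈ Set.Iio μ) => dirichletEigenspace Ω ν) ν hν)
        ⟨h, hmem, hu⟩
    rw [SetLike.mem_coe, Submodule.mem_orthogonal_singleton_iff_inner_left, inner_eq_fst_add_snd]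
    have h1 : inner ℝ u g.fst = 0 := hgV u huV
    have h2 := hu g hgH
    rw [h1, mul_zero] at h2
    change inner ℝ u g.fst + inner ℝ h g.snd = 0
    rw [h1, h2, add_zero]
  have hEL : ∀ p ∈ H10 Ω, inner ℝ g.fst p.fst = τ * inner ℝ g p := by
    intro p hp
    set x : L2 Ω := V.starProjection p.fst with hx
    have hxV : x ∈ V := V.starProjection_apply_mem _
    obtain ⟨q, ⟨hqH, hqg⟩, hqx⟩ := hVlift hxV
    replace hqx : q.fst = x := hqx
    rw [SetLike.mem_coe, Submodule.mem_orthogonal_singleton_iff_inner_right] at hqg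
    have h1 := hg' (p - q) ((H10 Ω).sub_mem hp hqH) (by
      change p.fst - q.fst ∈ Vᗮ
      rw [hqx]
      exact V.sub_starProjection_mem_orthogonal _)
    have h2 : inner ℝ g.fst x = 0 := (Submodule.mem_orthogonal' _ _).mp hgV x hxV
    have h3 : inner ℝ g.fst (p - q).fst = inner ℝ g.fst p.fst := by
      change inner ℝ g.fst (p.fst - q.fst) = _
      rw [inner_sub_right, hqx, h2, sub_zero]
    rw [h3, inner_sub_right, hqg, sub_zero] at h1
    exact h1
  have hgE : g.fst ∈ dirichletEigenspace Ω (1 / τ - 1) := by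
    refine ⟨g.snd, hgH, fun p hp => ?_⟩
    have := hEL p hp
    rw [inner_eq_fst_add_snd] at this
    field_simp
    linarith
  have hν : 1 / τ - 1 ∈ Set.Iio μ := by
    have : 1 / τ ≤ 1 + C := by
      rw [div_le_iff₀ hτ0]
      linarith
    simp only [Set.mem_Iio]
    linarith
  have hgmem : g.fst ∈ V := by
    rw [hV]
    exact (le_iSup₂ (f := fun ν (_ : ν ∈ Set.Iio μ) => dirichletEigenspace Ω ν) _ hν) hgE
  have hgz : g.fst = 0 := inner_self_eq_zero (𝕜 := ℝ).mp (hgV _ hgmem)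
  have h1 := hEL g hgH
  rw [hgz, inner_zero_left, eq_comm, mul_eq_zero, inner_self_eq_zero] at h1
  exact hg0 (Subtype.ext (h1.resolve_left hτ0.ne'))

/-- The upper half of the min-max principle. -/
theorem IsKthDirichletEigenvalue.le_of_rayleigh_le (hfin : volume Ω < ⊤) {k : ℕ} {μ C : ℝ}
    (hμ : IsKthDirichletEigenvalue Ω k μ) (W : Submodule ℝ (WithLp 2 (L2 Ω × L2Vec Ω)))
    [FiniteDimensional ℝ W] (hW : W ≤ H10 Ω) (hk : k ≤ Module.finrank ℝ W)
    (hle : ∀ p ∈ W, ‖p.snd‖ ^ 2 ≤ C * ‖p.fst‖ ^ 2) : μ ≤ C := by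
  obtain ⟨V, hV⟩ : ∃ V, V = ⨆ ν ∈ Set.Iio μ, dirichletEigenspace Ω ν := ⟨_, rfl⟩
  have hrank : Module.rank ℝ V < k := hV ▸ hμ.1
  have : FiniteDimensional ℝ V :=
    Module.rank_lt_aleph0_iff.mp (hrank.trans (Cardinal.natCast_lt_aleph0))
  have hfr : Module.finrank ℝ V < k := Module.finrank_lt_of_rank_lt hrank
  let f : W →ₗ[ℝ] V := V.orthogonalProjectionOnto.toLinearMap ∘ₗ
    (WithLp.fstL 2 ℝ (L2 Ω) (L2Vec Ω)).toLinearMap ∘ₗ W.subtype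
  have hker : LinearMap.ker f ≠ ⊥ := LinearMap.ker_ne_bot_of_finrank_lt (hfr.trans_le hk)
  obtain ⟨⟨w, hwW⟩, hwf, hw0⟩ := (Submodule.ne_bot_iff _).mp hker
  have hwV : w.fst ∈ Vᗮ := Submodule.orthogonalProjectionOnto_eq_zero_iff.mp hwf
  refine le_of_rayleigh_le_of_mem_orthogonal hfin hV (hW hwW) (fun h => hw0 ?_) hwV (hle w hwW)
  have h1 := hle w hwW
  have h2 := norm_sq_eq_fst_add_snd w
  rw [h, norm_zero] at h1 h2
  have h3 : ‖w‖ ^ 2 = 0 := le_antisymm (by nlinarith) (sq_nonneg _)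
  exact Subtype.ext (norm_eq_zero.mp (pow_eq_zero_iff two_ne_zero |>.mp h3))

end

/-! ### Trial functions in a ball -/

section

variable {m : ℕ} {Ω : Set (Space m)} {v w : Space m → ℝ}

theorem inner_toH10_fst (hv : IsTestFunction Ω v) (hw : IsTestFunction Ω w) :
    inner ℝ hv.toH10.fst hw.toH10.fst = ∫ x, v x * w x := by
  rw [L2.inner_def, ← setIntegral_eq_integral_of_forall_compl_eq_zero (s := Ω)
    (f := fun x => v x * w x) fun x hx => by rw [hv.eq_zero_of_notMem hx, zero_mul]]
  refine integral_congr_ae ?_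
  filter_upwards [hv.toH10_fst, hw.toH10_fst] with x h1 h2
  rw [h1, h2]
  simp [mul_comm]

theorem inner_toH10_snd (hv : IsTestFunction Ω v) (hw : IsTestFunction Ω w) :
    inner ℝ hv.toH10.snd hw.toH10.snd = ∫ x, inner ℝ (gradient v x) (gradient w x) := by
  rw [L2.inner_def, ← setIntegral_eq_integral_of_forall_compl_eq_zero (s := Ω)
    (f := fun x => inner ℝ (gradient v x) (gradient w x))
    fun x hx => by rw [hv.gradient_eq_zero_of_notMem hx, inner_zero_left]]
  refine integral_congr_ae ?_
  filter_upwards [hv.toH10_snd, hw.toH10_snd] with x h1 h2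
  rw [h1, h2]

/-- The function `ψ` moved to the centre `c` and dilated by the factor `R`. -/
noncomputable def rescale (ψ : Space m → ℝ) (c : Space m) (R : ℝ) (x : Space m) : ℝ :=
  ψ (R⁻¹ • (x - c))

theorem gradient_rescale (ψ : Space m → ℝ) (c : Space m) (R : ℝ) (x : Space m) :
    gradient (rescale ψ c R) x = R⁻¹ • gradient ψ (R⁻¹ • (x - c)) := by
  have h1 : fderiv ℝ (rescale ψ c R) x = fderiv ℝ (fun y => ψ (R⁻¹ • y)) (x - c) :=
    fderiv_comp_sub (f := fun y => ψ (R⁻¹ • y)) c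
  rw [gradient, h1, fderiv_comp_smul, gradient]
  simp

theorem integral_comp_rescale (f : Space m → ℝ) (c : Space m) {R : ℝ} (hR : 0 ≤ R) :
    ∫ x, f (R⁻¹ • (x - c)) = R ^ m * ∫ x, f x := by
  rw [integral_sub_right_eq_self (fun x => f (R⁻¹ • x)) c,
    Measure.integral_comp_inv_smul_of_nonneg _ _ hR]
  simp

theorem support_rescale_subset {ψ : Space m → ℝ} {r : ℝ}
    (hψ : Function.support ψ ⊆ Metric.closedBall 0 r) (c : Space m) {R : ℝ} (hR : 0 < R) :
    Function.support (rescale ψ c R) ⊆ Metric.closedBall c (R * r) := by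
  intro x hx
  have h1 : ‖R⁻¹ • (x - c)‖ ≤ r := by simpa using hψ hx
  rw [norm_smul, Real.norm_of_nonneg (by positivity), inv_mul_le_iff₀ hR] at h1
  rwa [Metric.mem_closedBall, dist_eq_norm]

theorem tsupport_rescale_subset {ψ : Space m → ℝ} {r : ℝ}
    (hψ : Function.support ψ ⊆ Metric.closedBall 0 r) (c : Space m) {R : ℝ} (hR : 0 < R) :
    tsupport (rescale ψ c R) ⊆ Metric.closedBall c (R * r) :=
  closure_minimal (support_rescale_subset hψ c hR) Metric.isClosed_closedBall

theorem isTestFunction_rescale {ψ : Space m → ℝ} (hψ : ContDiff ℝ ∞ ψ) {r : ℝ}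
    (hψr : Function.support ψ ⊆ Metric.closedBall 0 r) {c : Space m} {R : ℝ} (hR : 0 < R)
    (hΩ : Metric.closedBall c (R * r) ⊆ Ω) : IsTestFunction Ω (rescale ψ c R) where
  contDiff := hψ.comp (by fun_prop)
  hasCompactSupport :=
    HasCompactSupport.of_support_subset_isCompact (isCompact_closedBall c (R * r))
      (support_rescale_subset hψr c hR)
  tsupport_subset := (tsupport_rescale_subset hψr c hR).trans hΩ

/-- Proportionality of the Dirichlet form to the `L²` inner product passes from a family to its
span. -/
theorem inner_snd_eq_mul_inner_fst_of_mem_span {C : ℝ} {ι : Type*}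
    (p : ι → WithLp 2 (L2 Ω × L2Vec Ω))
    (h : ∀ i j, inner ℝ (p i).snd (p j).snd = C * inner ℝ (p i).fst (p j).fst)
    {q : WithLp 2 (L2 Ω × L2Vec Ω)} (hq : q ∈ Submodule.span ℝ (Set.range p)) :
    ‖q.snd‖ ^ 2 = C * ‖q.fst‖ ^ 2 := by
  have key : ∀ x ∈ Submodule.span ℝ (Set.range p), ∀ y ∈ Submodule.span ℝ (Set.range p),
      inner ℝ x.snd y.snd = C * inner ℝ x.fst y.fst := by
    intro x hx y hy
    induction hx, hy using Submodule.span_induction₂ with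
    | mem_mem x y hx hy =>
      obtain ⟨i, rfl⟩ := hx
      obtain ⟨j, rfl⟩ := hy
      exact h i j
    | zero_left y hy => simp
    | zero_right x hx => simp
    | add_left x y z _ _ _ h1 h2 =>
      simp only [WithLp.add_fst, WithLp.add_snd, inner_add_left, h1, h2, mul_add]
    | add_right x y z _ _ _ h1 h2 =>
      simp only [WithLp.add_fst, WithLp.add_snd, inner_add_right, h1, h2, mul_add]
    | smul_left r x y _ _ h1 =>
      simp only [WithLp.smul_fst, WithLp.smul_snd, real_inner_smul_left, h1]
      ring
    | smul_right r x y _ _ h1 =>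
      simp only [WithLp.smul_fst, WithLp.smul_snd, real_inner_smul_right, h1]
      ring
  simpa only [real_inner_self_eq_norm_sq] using key q hq q hq

/-- A ball of radius `ρ` contains `k` disjoint balls of radius `ρ / (4 k)`, and so supports a
`k`-dimensional space of functions whose Rayleigh quotients all equal a constant over `ρ²`. -/
theorem exists_trial_space (hm : 1 ≤ m) {k : ℕ} (hk : 1 ≤ k) :
    ∃ K : ℝ, ∀ (Ω : Set (Space m)) (x₀ : Space m) (ρ : ℝ), 0 < ρ → Metric.ball x₀ ρ ⊆ Ω →
      ∃ W : Submodule ℝ (WithLp 2 (L2 Ω × L2Vec Ω)), W ≤ H10 Ω ∧ FiniteDimensional ℝ W ∧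
        Module.finrank ℝ W = k ∧ ∀ p ∈ W, ‖p.snd‖ ^ 2 = K / ρ ^ 2 * ‖p.fst‖ ^ 2 := by
  let φ : ContDiffBump (0 : Space m) := ⟨1 / 4, 1 / 2, by norm_num, by norm_num⟩
  set ψ : Space m → ℝ := fun x => φ x with hψ
  have hψs : Function.support ψ ⊆ Metric.closedBall 0 (1 / 2) := by
    rw [hψ, φ.support_eq]
    exact Metric.ball_subset_closedBall
  have hψd : ContDiff ℝ ∞ ψ := φ.contDiff
  set I₀ := ∫ x, ψ x * ψ x with hI₀
  set I₁ := ∫ x, inner ℝ (gradient ψ x) (gradient ψ x) with hI₁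
  have hI₀pos : 0 < I₀ := by
    have hcont : Continuous fun x => ψ x * ψ x := by
      have := hψd.continuous
      fun_prop
    refine hcont.integral_pos_of_hasCompactSupport_nonneg_nonzero
      (φ.hasCompactSupport.mul_right) (fun x => mul_self_nonneg _) (x := 0) ?_
    have : 0 < ψ 0 := φ.pos_of_mem_ball (Metric.mem_ball_self φ.rOut_pos)
    positivity
  obtain ⟨e, he⟩ : ∃ e : Space m, ‖e‖ = 1 :=
    ⟨EuclideanSpace.single ⟨0, hm⟩ 1, by simp⟩
  have hk0 : (1 : ℝ) ≤ k := by exact_mod_cast hk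
  refine ⟨16 * k ^ 2 * (I₁ / I₀), fun Ω x₀ ρ hρ hball => ?_⟩
  set R : ℝ := ρ / (4 * k) with hR
  have hRpos : 0 < R := by positivity
  have hρR : ρ = 4 * k * R := by rw [hR]; field_simp
  -- Centres at mutual distance at least `2 R` on a segment of length less than `ρ / 2`.
  set c : Fin k → Space m := fun i => x₀ + (2 * R * (i : ℝ)) • e with hc
  have hdist : ∀ i j : Fin k, i ≠ j → 2 * R ≤ dist (c i) (c j) := by
    intro i j hij
    rw [hc, dist_eq_norm, add_sub_add_left_eq_sub, ← sub_smul, norm_smul, he, mul_one, ← mul_sub,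
      Real.norm_eq_abs, abs_mul, abs_of_pos (by positivity)]
    have : (1 : ℝ) ≤ |(i : ℝ) - j| := by
      have h1 : (1 : ℤ) ≤ |(i : ℤ) - j| := Int.one_le_abs (by
        intro h
        exact hij (Fin.ext (by omega)))
      exact_mod_cast h1
    nlinarith
  have hsub : ∀ i, Metric.closedBall (c i) (R * (1 / 2)) ⊆ Ω := by
    intro i
    refine Set.Subset.trans ?_ hball
    refine Metric.closedBall_subset_ball' ?_
    have h1 : dist (c i) x₀ = 2 * R * i := by
      rw [hc, dist_eq_norm, add_sub_cancel_left, norm_smul, he, mul_one,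
        Real.norm_of_nonneg (by positivity)]
    have h2 : ((i : ℕ) : ℝ) + 1 ≤ k := by exact_mod_cast i.2
    rw [h1, hρR]
    nlinarith
  have htest : ∀ i, IsTestFunction Ω (rescale ψ (c i) R) := fun i =>
    isTestFunction_rescale hψd hψs hRpos (hsub i)
  have hdisj : ∀ i j, i ≠ j → ∀ x, x ∈ tsupport (rescale ψ (c i) R) →
      x ∉ tsupport (rescale ψ (c j) R) := by
    intro i j hij x hi hj
    have h1 := Metric.mem_closedBall.mp (tsupport_rescale_subset hψs (c i) hRpos hi)
    have h2 := Metric.mem_closedBall.mp (tsupport_rescale_subset hψs (c j) hRpos hj)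
    have h3 := dist_triangle_left (c i) (c j) x
    have h4 := hdist i j hij
    linarith
  have hfst : ∀ i j, inner ℝ (htest i).toH10.fst (htest j).toH10.fst =
      if i = j then R ^ m * I₀ else 0 := by
    intro i j
    rw [inner_toH10_fst]
    split_ifs with hij
    · subst hij
      exact integral_comp_rescale (fun x => ψ x * ψ x) (c i) hRpos.le
    · rw [← integral_zero (Space m) ℝ]
      congr 1
      ext x
      by_cases hx : x ∈ tsupport (rescale ψ (c i) R)
      · rw [image_eq_zero_of_notMem_tsupport (hdisj i j hij x hx), mul_zero]
      · rw [image_eq_zero_of_notMem_tsupport hx, zero_mul]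
  have hsnd : ∀ i j, inner ℝ (htest i).toH10.snd (htest j).toH10.snd =
      if i = j then R ^ m * ((R⁻¹) ^ 2 * I₁) else 0 := by
    intro i j
    rw [inner_toH10_snd]
    split_ifs with hij
    · subst hij
      simp_rw [gradient_rescale, real_inner_smul_left, real_inner_smul_right]
      rw [integral_comp_rescale
        (fun x => R⁻¹ * (R⁻¹ * inner ℝ (gradient ψ x) (gradient ψ x))) (c i) hRpos.le]
      simp_rw [integral_const_mul]
      rw [← hI₁]
      ring
    · rw [← integral_zero (Space m) ℝ]
      congr 1
      ext x
      have hg : ∀ l, x ∉ tsupport (rescale ψ (c l) R) → gradient (rescale ψ (c l) R) x = 0 := by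
        intro l hl
        have : fderiv ℝ (rescale ψ (c l) R) x = 0 := by
          by_contra h
          exact hl (support_fderiv_subset ℝ h)
        simp [gradient, this]
      by_cases hx : x ∈ tsupport (rescale ψ (c i) R)
      · rw [hg j (hdisj i j hij x hx), inner_zero_right]
      · rw [hg i hx, inner_zero_left]
  set p : Fin k → WithLp 2 (L2 Ω × L2Vec Ω) := fun i => (htest i).toH10 with hp
  have hpI : ∀ i j, inner ℝ (p i).snd (p j).snd =
      16 * k ^ 2 * (I₁ / I₀) / ρ ^ 2 * inner ℝ (p i).fst (p j).fst := by
    intro i j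
    rw [hp, hfst, hsnd]
    split_ifs with hij
    · rw [hρR]
      field_simp
      ring
    · simp
  have hli : LinearIndependent ℝ p := by
    refine linearIndependent_of_ne_zero_of_inner_eq_zero (𝕜 := ℝ) (fun i h0 => ?_)
      fun i j hij => ?_
    · have h1 := hfst i i
      have h2 : (htest i).toH10 = 0 := h0
      rw [if_pos rfl, h2] at h1
      have h3 : 0 < R ^ m * I₀ := by positivity
      rw [← h1] at h3
      simp at h3
    · change inner ℝ (p i) (p j) = 0
      rw [inner_eq_fst_add_snd, hpI, hp, hfst, if_neg hij]
      simp
  refine ⟨Submodule.span ℝ (Set.range p), ?_,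
    FiniteDimensional.span_of_finite ℝ (Set.finite_range p), ?_, fun q hq => inner_snd_eq_mul_inner_fst_of_mem_span p hpI hq⟩
  · rw [Submodule.span_le]
    rintro _ ⟨i, rfl⟩
    exact (htest i).toH10_mem
  · rw [finrank_span_eq_card hli, Fintype.card_fin]

/-- Domain monotonicity and scaling: the `k`-th eigenvalue of a set containing a ball of radius
`ρ` is at most a constant depending on `m` and `k` only, divided by `ρ²`. -/
theorem exists_forall_eigenvalue_le (hm : 1 ≤ m) {k : ℕ} (hk : 1 ≤ k) :
    ∃ K : ℝ, ∀ (Ω : Set (Space m)) (x₀ : Space m) (ρ μ : ℝ), volume Ω < ⊤ → 0 < ρ →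
      Metric.ball x₀ ρ ⊆ Ω → IsKthDirichletEigenvalue Ω k μ → μ ≤ K / ρ ^ 2 := by
  obtain ⟨K, hK⟩ := exists_trial_space hm hk
  refine ⟨K, fun Ω x₀ ρ μ hfin hρ hball hμ => ?_⟩
  obtain ⟨W, hW, _, hWk, hWK⟩ := hK Ω x₀ ρ hρ hball
  exact hμ.le_of_rayleigh_le hfin W hW hWk.ge fun p hp => (hWK p hp).le

end

/-! ### The Hardy inequality for eigenfunctions -/

section

variable {m : ℕ} {Ω : Set (Space m)}

theorem nonempty_compl_of_volume_lt_top (hm : 1 ≤ m) (hfin : volume Ω < ⊤) : Ωᶜ.Nonempty := by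
  have : Nonempty (Fin m) := ⟨⟨0, hm⟩⟩
  rw [Set.nonempty_compl]
  rintro rfl
  rw [measure_univ_of_isAddLeftInvariant] at hfin
  exact lt_irrefl _ hfin

theorem bdryDist_pos (hΩ : IsOpen Ω) (hne : Ωᶜ.Nonempty) {x : Space m} (hx : x ∈ Ω) :
    0 < bdryDist Ω x :=
  (hΩ.isClosed_compl.notMem_iff_infDist_pos hne).mp (fun h => h hx)

/-- The volume of the balls `B(x, d_Ω(x)) ⊆ Ω` is bounded, so the suprema of `d_Ω` over subsets of
`Ω` are genuine suprema. -/
theorem bddAbove_bdryDist (hm : 1 ≤ m) (hfin : volume Ω < ⊤) :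
    BddAbove (bdryDist Ω '' Ω) := by
  set β := volume.real (Metric.ball (0 : Space m) 1) with hβ
  have hβpos : 0 < β :=
    ENNReal.toReal_pos (Metric.measure_ball_pos volume _ one_pos).ne' measure_ball_lt_top.ne
  refine ⟨max 1 (volume.real Ω / β), ?_⟩
  rintro _ ⟨x, -, rfl⟩
  by_contra! h
  obtain ⟨h1, h2⟩ := max_lt_iff.mp h
  rw [div_lt_iff₀ hβpos] at h2
  have h3 : volume.real (Metric.ball x (bdryDist Ω x)) ≤ volume.real Ω :=
    measureReal_mono Metric.ball_infDist_compl_subset hfin.ne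
  have h4 : volume.real (Metric.ball x (bdryDist Ω x)) = bdryDist Ω x ^ m * β := by
    have : Nonempty (Fin m) := ⟨⟨0, hm⟩⟩
    have hd0 : 0 ≤ bdryDist Ω x := by linarith
    rw [Measure.real, Measure.addHaar_ball _ _ hd0, ENNReal.toReal_mul,
      ENNReal.toReal_ofReal (by positivity)]
    simp [hβ, Measure.real]
  have h5 : bdryDist Ω x ≤ bdryDist Ω x ^ m := le_self_pow₀ h1.le (by omega)
  nlinarith

theorem IsTestFunction.integrable_sq_div_bdryDist_sq (hΩ : IsOpen Ω) (hne : Ωᶜ.Nonempty)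
    {w : Space m → ℝ} (hw : IsTestFunction Ω w) :
    Integrable fun x => w x ^ 2 / bdryDist Ω x ^ 2 := by
  have hcs : HasCompactSupport fun x => w x ^ 2 / bdryDist Ω x ^ 2 :=
    hw.hasCompactSupport.mono fun x hx hwx => hx (by simp [hwx])
  refine Continuous.integrable_of_hasCompactSupport ?_ hcs
  rw [continuous_iff_continuousAt]
  intro x
  by_cases hx : x ∈ tsupport w
  · exact (hw.contDiff.continuous.continuousAt.pow 2).div
      ((Metric.continuous_infDist_pt _).continuousAt.pow 2)
      (pow_ne_zero 2 (bdryDist_pos hΩ hne (hw.tsupport_subset hx)).ne')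
  · have h0 : (fun x => w x ^ 2 / bdryDist Ω x ^ 2) =ᶠ[𝓝 x] fun _ => 0 := by
      filter_upwards [notMem_tsupport_iff_eventuallyEq.mp hx] with y hy
      simp [hy]
    exact continuousAt_const.congr h0.symm

theorem StrongHardy.setIntegral_sq_le {c : ℝ} (hH : StrongHardy Ω c) (hΩ : IsOpen Ω)
    (hne : Ωᶜ.Nonempty) {A : Set (Space m)} (hA : A ⊆ Ω) (hAm : NullMeasurableSet A volume)
    {S : ℝ} (hS : ∀ x ∈ A, bdryDist Ω x ≤ S) {w : Space m → ℝ} (hw : IsTestFunction Ω w) :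
    ∫ x in A, w x ^ 2 ≤ S ^ 2 * c * ∫ x in Ω, ‖gradient w x‖ ^ 2 := by
  have hint := hw.integrable_sq_div_bdryDist_sq hΩ hne
  have h1 : ∫ x in A, w x ^ 2 ≤ ∫ x in A, S ^ 2 * (w x ^ 2 / bdryDist Ω x ^ 2) := by
    refine integral_mono_ae (hw.memLp _).integrable_sq (hint.const_mul _).integrableOn ?_
    refine (ae_restrict_iff'₀ hAm).mpr (Eventually.of_forall fun x hx => ?_)
    have hd := bdryDist_pos hΩ hne (hA hx)
    have : bdryDist Ω x ^ 2 ≤ S ^ 2 := pow_le_pow_left₀ hd.le (hS x hx) 2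
    change w x ^ 2 ≤ S ^ 2 * (w x ^ 2 / bdryDist Ω x ^ 2)
    rw [← mul_div_assoc, le_div_iff₀ (by positivity), mul_comm]
    gcongr
  have h2 : ∫ x in A, w x ^ 2 / bdryDist Ω x ^ 2 ≤ ∫ x in Ω, w x ^ 2 / bdryDist Ω x ^ 2 :=
    setIntegral_mono_set hint.integrableOn (Eventually.of_forall fun x => by positivity)
      (Eventually.of_forall hA)
  have h3 : ∫ x in Ω, w x ^ 2 / bdryDist Ω x ^ 2 ≤ c * ∫ x in Ω, ‖gradient w x‖ ^ 2 := by
    have := hH.2 w hw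
    rwa [one_div, inv_mul_le_iff₀ hH.1] at this
  rw [integral_const_mul] at h1
  calc ∫ x in A, w x ^ 2 ≤ S ^ 2 * ∫ x in A, w x ^ 2 / bdryDist Ω x ^ 2 := h1
    _ ≤ S ^ 2 * (c * ∫ x in Ω, ‖gradient w x‖ ^ 2) := by
        gcongr
        exact h2.trans h3
    _ = _ := by ring

theorem norm_sq_eq_integral {X E : Type*} [MeasurableSpace X] {ν : Measure X}
    [NormedAddCommGroup E] [InnerProductSpace ℝ E] (f : Lp E 2 ν) :
    ‖f‖ ^ 2 = ∫ x, ‖f x‖ ^ 2 ∂ν := by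
  rw [← real_inner_self_eq_norm_sq, L2.inner_def]
  simp_rw [real_inner_self_eq_norm_sq]

/-- By density, the Hardy inequality bounds the mass of `u ∈ H_0^1(Ω)` close to the boundary. -/
theorem StrongHardy.norm_restrict_sq_le {c : ℝ} (hH : StrongHardy Ω c) (hΩ : IsOpen Ω)
    (hne : Ωᶜ.Nonempty) {A : Set (Space m)} (hA : A ⊆ Ω) (hAm : NullMeasurableSet A volume)
    {S : ℝ} (hS : ∀ x ∈ A, bdryDist Ω x ≤ S) {p : WithLp 2 (L2 Ω × L2Vec Ω)} (hp : p ∈ H10 Ω) :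
    ‖LpToLpRestrictCLM (Space m) ℝ ℝ (volume.restrict Ω) 2 A p.fst‖ ^ 2 ≤
      S ^ 2 * c * ‖p.snd‖ ^ 2 := by
  have h1 : Continuous fun p : WithLp 2 (L2 Ω × L2Vec Ω) => p.fst :=
    (WithLp.fstL 2 ℝ (L2 Ω) (L2Vec Ω)).continuous
  have h2 : Continuous fun p : WithLp 2 (L2 Ω × L2Vec Ω) => p.snd :=
    (WithLp.sndL 2 ℝ (L2 Ω) (L2Vec Ω)).continuous
  refine H10_induction (S := {p |
    ‖LpToLpRestrictCLM (Space m) ℝ ℝ (volume.restrict Ω) 2 A p.fst‖ ^ 2 ≤ S ^ 2 * c * ‖p.snd‖ ^ 2})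
    (isClosed_le
      (((ContinuousLinearMap.continuous _).comp h1).norm.pow 2)
      (continuous_const.mul (h2.norm.pow 2))) (fun w hw => ?_) hp
  rw [Set.mem_ofPred_eq, norm_sq_eq_integral, norm_sq_eq_integral]
  have e1 : ∫ x, ‖LpToLpRestrictCLM (Space m) ℝ ℝ (volume.restrict Ω) 2 A hw.toH10.fst x‖ ^ 2
      ∂((volume.restrict Ω).restrict A) = ∫ x in A, w x ^ 2 := by
    rw [← Measure.restrict_restrict_of_subset (μ := volume) hA]
    refine integral_congr_ae ?_
    filter_upwards [LpToLpRestrictCLM_coeFn ℝ A hw.toH10.fst,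
      ae_restrict_of_ae hw.toH10_fst] with x hx1 hx2
    rw [hx1, hx2, Real.norm_eq_abs, sq_abs]
  have e2 : ∫ x in Ω, ‖hw.toH10.snd x‖ ^ 2 = ∫ x in Ω, ‖gradient w x‖ ^ 2 := by
    refine integral_congr_ae ?_
    filter_upwards [hw.toH10_snd] with x hx
    rw [hx]
  rw [e1, e2]
  exact hH.setIntegral_sq_le hΩ hne hA hAm hS hw

/-- The gradient of a normalised eigenfunction has squared norm equal to the eigenvalue, so the
Hardy inequality bounds its mass near the boundary by the eigenvalue. -/
theorem StrongHardy.lintegral_eigenfunction_le {c : ℝ} (hH : StrongHardy Ω c) (hΩ : IsOpen Ω)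
    (hne : Ωᶜ.Nonempty) {A : Set (Space m)} (hA : A ⊆ Ω) (hAm : NullMeasurableSet A volume)
    {S : ℝ} (hS : ∀ x ∈ A, bdryDist Ω x ≤ S) {u : L2 Ω} {μ : ℝ}
    (hu : u ∈ dirichletEigenspace Ω μ) (hu1 : ‖u‖ = 1) :
    ∫⁻ x in A, ‖u x‖ₑ ^ 2 ≤ ENNReal.ofReal (S ^ 2 * c * μ) := by
  obtain ⟨g, hg, hug⟩ := hu
  have hgμ : ‖g‖ ^ 2 = μ := by
    have := hug _ hg
    rw [← real_inner_self_eq_norm_sq]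
    refine this.trans ?_
    change μ * inner ℝ u u = μ
    rw [real_inner_self_eq_norm_sq, hu1]
    norm_num
  have h := hH.norm_restrict_sq_le hΩ hne hA hAm hS hg
  have h' : ‖LpToLpRestrictCLM (Space m) ℝ ℝ (volume.restrict Ω) 2 A u‖ ^ 2 ≤ S ^ 2 * c * μ := by
    rw [← hgμ]
    exact h
  calc ∫⁻ x in A, ‖u x‖ₑ ^ 2
      = ‖LpToLpRestrictCLM (Space m) ℝ ℝ (volume.restrict Ω) 2 A u‖ₑ ^ 2 := by
        rw [enorm_sq_eq_lintegral, ← Measure.restrict_restrict_of_subset (μ := volume) hA]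
        refine lintegral_congr_ae ?_
        filter_upwards [LpToLpRestrictCLM_coeFn ℝ A u] with x hx
        rw [hx]
    _ ≤ _ := by
        rw [← ofReal_norm, ← ENNReal.ofReal_pow (norm_nonneg _)]
        exact ENNReal.ofReal_le_ofReal h'

/-- The mass of a `k`-th eigenfunction on a set `A` is controlled by the ratio of the greatest
distances to the boundary in `A` and in `Ω`. -/
theorem exists_forall_lintegral_eigenfunction_le (hm : 1 ≤ m) {k : ℕ} (hk : 1 ≤ k) :
    ∃ K : ℝ, ∀ (Ω : Set (Space m)) (c : ℝ) (A : Set (Space m)) (u : L2 Ω), IsOpen Ω →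
      0 < volume Ω → volume Ω < ⊤ → StrongHardy Ω c → A ⊆ Ω → NullMeasurableSet A volume →
      IsKthDirichletEigenfunction Ω k u →
      ∫⁻ x in A, ‖u x‖ₑ ^ 2 ≤
        ENNReal.ofReal ((sSup (bdryDist Ω '' A) / sSup (bdryDist Ω '' Ω)) ^ 2 * (K * c)) := by
  obtain ⟨K, hK⟩ := exists_forall_eigenvalue_le hm hk
  refine ⟨4 * |K|, fun Ω c A u hΩ hpos hfin hH hA hAm ⟨μ, hμ, hu, hu1⟩ => ?_⟩
  have hne := nonempty_compl_of_volume_lt_top hm hfin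
  have hbdd := bddAbove_bdryDist hm hfin
  set S := sSup (bdryDist Ω '' A)
  set D := sSup (bdryDist Ω '' Ω)
  have hS : ∀ x ∈ A, bdryDist Ω x ≤ S := fun x hx =>
    le_csSup (hbdd.mono (Set.image_mono hA)) (Set.mem_image_of_mem _ hx)
  obtain ⟨x₁, hx₁⟩ : Ω.Nonempty := nonempty_of_measure_ne_zero hpos.ne'
  have hD : 0 < D :=
    (bdryDist_pos hΩ hne hx₁).trans_le (le_csSup hbdd (Set.mem_image_of_mem _ hx₁))
  -- The supremum need not be known to be attained: half of it is enough.
  obtain ⟨_, ⟨x₀, -, rfl⟩, hx₀⟩ := exists_lt_of_lt_csSup (s := bdryDist Ω '' Ω)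
    ⟨_, Set.mem_image_of_mem _ hx₁⟩ (half_lt_self hD)
  have hμ1 : μ ≤ 4 * |K| / D ^ 2 := by
    have h1 := hK Ω x₀ (bdryDist Ω x₀) μ hfin (by linarith) Metric.ball_infDist_compl_subset hμ
    calc μ ≤ K / bdryDist Ω x₀ ^ 2 := h1
      _ ≤ |K| / (D / 2) ^ 2 := by
          gcongr
          exact le_abs_self K
      _ = 4 * |K| / D ^ 2 := by ring
  refine (hH.lintegral_eigenfunction_le hΩ hne hA hAm hS hu hu1).trans
    (ENNReal.ofReal_le_ofReal ?_)
  have hc := hH.1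
  calc S ^ 2 * c * μ ≤ S ^ 2 * c * (4 * |K| / D ^ 2) := by gcongr
    _ = (S / D) ^ 2 * (4 * |K| * c) := by ring

end

/-! ### Localisation -/

/-- A normalised sequence whose mass tends to zero on sets of almost full relative measure
localises, the localising sets being the complements. -/
theorem localisesInLp_two_of_tendsto {m : ℕ} {Ω : ℕ → Set (Space m)}
    (hopen : ∀ n, IsOpen (Ω n)) (hpos : ∀ n, 0 < volume (Ω n)) (hfin : ∀ n, volume (Ω n) < ⊤)
    {A : ℕ → Set (Space m)} (hAsub : ∀ n, A n ⊆ Ω n)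
    (hAmeas : ∀ n, NullMeasurableSet (A n) volume)
    (hAvol : Tendsto (fun n => volume (A n) / volume (Ω n)) atTop (𝓝 1))
    {u : (n : ℕ) → L2 (Ω n)} (hu : ∀ n, ‖u n‖ = 1)
    (hA : Tendsto (fun n => ∫⁻ x in A n, ‖u n x‖ₑ ^ 2) atTop (𝓝 0)) :
    LocalisesInLp 2 Ω (fun n => ⇑(u n)) := by
  have hone : ∀ n, ∫⁻ x in Ω n, ‖u n x‖ₑ ^ 2 = 1 := fun n => by
    rw [← enorm_sq_eq_lintegral, ← ofReal_norm, hu]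
    simp
  have hle : ∀ n, ∀ B ⊆ Ω n, ∫⁻ x in B, ‖u n x‖ₑ ^ 2 ≤ 1 := fun n B hB =>
    (lintegral_mono_set hB).trans (hone n).le
  simp only [LocalisesInLp, localisationConstant, ENNReal.rpow_two, hone, div_one]
  refine le_antisymm (iSup₂_le fun B hB => ?_) ?_
  · exact limsup_le_of_le (h := Eventually.of_forall fun n => hle n (B n) (hB.1 n).1)
  · refine le_iSup₂_of_le (fun n => Ω n \ A n) ⟨fun n => ⟨Set.sdiff_subset,
      (hopen n).measurableSet.nullMeasurableSet.diff (hAmeas n)⟩, ?_⟩ ?_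
    · have h : ∀ n, volume (Ω n \ A n) / volume (Ω n) = 1 - volume (A n) / volume (Ω n) := by
        intro n
        rw [measure_sdiff (hAsub n) (hAmeas n) ((measure_mono (hAsub n)).trans_lt (hfin n)).ne,
          ENNReal.sub_div fun _ _ => (hpos n).ne',
          ENNReal.div_self (hpos n).ne' (hfin n).ne]
      simp_rw [h]
      simpa using ENNReal.Tendsto.sub (tendsto_const_nhds (x := (1 : ℝ≥0∞))) hAvol
        (Or.inl ENNReal.one_ne_top)
    · have h1 : Tendsto (fun n => 1 - ∫⁻ x in A n, ‖u n x‖ₑ ^ 2) atTop (𝓝 1) := by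
        simpa using ENNReal.Tendsto.sub (tendsto_const_nhds (x := (1 : ℝ≥0∞))) hA
          (Or.inl ENNReal.one_ne_top)
      have h2 : Tendsto (fun n => ∫⁻ x in Ω n \ A n, ‖u n x‖ₑ ^ 2) atTop (𝓝 1) := by
        refine tendsto_of_tendsto_of_tendsto_of_le_of_le h1 tendsto_const_nhds (fun n => ?_)
          fun n => hle n _ Set.sdiff_subset
        change 1 - _ ≤ _
        rw [tsub_le_iff_right, ← hone n]
        have := lintegral_union_le (μ := volume) (fun x => ‖u n x‖ₑ ^ 2) (Ω n \ A n) (A n)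
        rwa [Set.sdiff_union_of_subset (hAsub n)] at this
      exact h2.limsup_eq.ge

end DirichletLocalisation

theorem mainTheorem2 (m : ℕ) (hm : 1 ≤ m)
    (Ω : ℕ → Set (DirichletLocalisation.Space m))
    (hopen : ∀ n, IsOpen (Ω n))
    (hpos : ∀ n, 0 < volume (Ω n)) (hfin : ∀ n, volume (Ω n) < ⊤)
    (c : ℕ → ℝ) (hHardy : ∀ n, DirichletLocalisation.StrongHardy (Ω n) (c n))
    (hc : BddAbove (Set.range c))
    (A : ℕ → Set (DirichletLocalisation.Space m))
    (hAsub : ∀ n, A n ⊆ Ω n)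
    (hAmeas : ∀ n, NullMeasurableSet (A n) volume)
    (hAvol : Tendsto (fun n => volume (A n) / volume (Ω n)) atTop (𝓝 1))
    (hAdist : Tendsto
      (fun n => sSup (DirichletLocalisation.bdryDist (Ω n) '' A n) /
        sSup (DirichletLocalisation.bdryDist (Ω n) '' Ω n)) atTop (𝓝 0))
    (k : ℕ) (hk : 1 ≤ k)
    (u : (n : ℕ) → DirichletLocalisation.L2 (Ω n))
    (hu : ∀ n, DirichletLocalisation.IsKthDirichletEigenfunction (Ω n) k (u n)) :
    DirichletLocalisation.LocalisesInLp 2 Ω (fun n => ⇑(u n)) := by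
  obtain ⟨K, hK⟩ := DirichletLocalisation.exists_forall_lintegral_eigenfunction_le hm hk
  obtain ⟨b, hb⟩ := hc
  have hb' : ∀ n, c n ≤ b := fun n => hb (Set.mem_range_self n)
  refine DirichletLocalisation.localisesInLp_two_of_tendsto hopen hpos hfin hAsub hAmeas hAvol
    (fun n => (hu n).choose_spec.2.2) ?_
  have hlim : Tendsto (fun n => ENNReal.ofReal
      ((sSup (DirichletLocalisation.bdryDist (Ω n) '' A n) /
        sSup (DirichletLocalisation.bdryDist (Ω n) '' Ω n)) ^ 2 * (|K| * b))) atTop (𝓝 0) := by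
    simpa using ENNReal.tendsto_ofReal ((hAdist.pow 2).mul_const (|K| * b))
  refine tendsto_of_tendsto_of_tendsto_of_le_of_le tendsto_const_nhds hlim (fun n => zero_le)
    fun n => ?_
  refine (hK (Ω n) (c n) (A n) (u n) (hopen n) (hpos n) (hfin n) (hHardy n) (hAsub n) (hAmeas n)
    (hu n)).trans (ENNReal.ofReal_le_ofReal ?_)
  have h0 := (hHardy n).1
  have h1 : K * c n ≤ |K| * b :=
    mul_le_mul (le_abs_self K) (hb' n) h0.le (abs_nonneg K)
  gcongr
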